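/- Let $a_1,a_2,a_3\in\mathbb R$, let $J\subseteq\mathbb R$ be open, and let $\beta:J\to(0,\infty)$ be smooth. Equip $N=\mathbb R^2\times J$ with the Riemannian metric $h=\beta(z)^{-2}(dx^2+dy^2+dz^2)$. Let $U\subseteq\mathbb R^2$ be a nonempty connected open set such that $a_1x+a_2y+a_3\in J$ for all $(x,y)\in U$ (for instance $U=\mathbb R^2$, $J=\mathbb R$), let $\varphi:U\to N$, $\varphi(x,y)=(x,y,a_1x+a_2y+a_3)$, and let $f:U\to(0,\infty)$ be smooth. For a smooth map $\varphi:(M,g)\to(N,h)$ of Riemannian manifolds let $\tau(\varphi)=\operatorname{Trace}_g\nabla d\varphi$ be the tension field and $$\tau_2(\varphi)=\operatorname{Trace}_g(\nabla^\varphi\nabla^\varphi-\nabla^\varphi_{\nabla^M})\tau(\varphi)-\operatorname{Trace}_gR^N(d\varphi,\tau(\varphi))d\varphi,\qquad R^N(X,Y)=[\nabla^N_X,\nabla^N_Y]-\nabla^N_{[X,Y]}.$$ The map is harmonic if $\tau(\varphi)\equiv0$, biharmonic if $\tau_2(\varphi)\equiv0$, and proper biharmonic if it is biharmonic but not harmonic.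 Then the map $\varphi:(U,f^{-1}\varphi^*h)\to(N,h)$ is proper biharmonic if and only if $\beta$ is nonconstant on $J$, $$\beta\beta''-2(\beta')^2=0\quad\text{at } z=a_1x+a_2y+a_3 \text{ for all } (x,y)\in U,$$ and there is a constant $c>0$ such that, for all $(x,y)\in U$ and $z=a_1x+a_2y+a_3$, one has $\beta'(z)\neq0$ and $$f(x,y)=\frac{c\sqrt{1+a_1^2+a_2^2}}{|\beta'(z)|}.$$ Moreover, $\varphi:(U,f^{-1}\varphi^*h)\to(N,h)$ is a conformal immersion with conformal factor $\lambda=f^{1/2}$, that is, $\varphi^*h=\lambda^2\,(f^{-1}\varphi^*h)$. With respect to the unit normal field $\xi=\beta(z)\,(-a_1,-a_2,1)/\sqrt{1+a_1^2+a_2^2}$, the surface $(U,\varphi^*h)$ has mean curvature $$H=\frac{\beta'(z)}{\sqrt{1+a_1^2+a_2^2}},\qquad z=a_1x+a_2y+a_3,$$ that is, its mean curvature vector field $\tfrac12\operatorname{Trace}_{\varphi^*h}\nabla d\varphi$ equals $H\xi$. -/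

import Mathlib

open scoped ContDiff

noncomputable section

namespace CoordGeom

/-- The partial derivative `∂ᵢ F` at `x`. -/
def pd {m : ℕ} (i : Fin m) (F : (Fin m → ℝ) → ℝ) (x : Fin m → ℝ) : ℝ :=
  fderiv ℝ F x (Pi.single i 1)

/-- A metric in the standard coordinates of (an open subset of) `ℝᵐ`: at each point `x` its
coefficient matrix `g x i j = g(∂ᵢ, ∂ⱼ)`. -/
abbrev Metric (m : ℕ) : Type := (Fin m → ℝ) → Matrix (Fin m) (Fin m) ℝ

/-- The scalar product `⟨X, Y⟩` of two tangent vectors at `x`. -/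
def Metric.ip {m : ℕ} (g : Metric m) (x X Y : Fin m → ℝ) : ℝ :=
  ∑ i, ∑ j, g x i j * X i * Y j

/-- The Christoffel symbol `Γᵏᵢⱼ` of the Levi-Civita connection of `g`. -/
def Metric.christoffel {m : ℕ} (g : Metric m) (k i j : Fin m) (x : Fin m → ℝ) : ℝ :=
  (1 / 2 : ℝ) * ∑ l, (g x)⁻¹ k l *
    (pd i (fun y => g y j l) x + pd j (fun y => g y i l) x - pd l (fun y => g y i j) x)

/-- The component `Rᵃ_{bcd}` of the curvature tensor, `R(∂_c, ∂_d) ∂_b = ∑ₐ Rᵃ_{bcd} ∂ₐ`, where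
`R(X, Y) Z = ∇_X ∇_Y Z - ∇_Y ∇_X Z - ∇_{[X, Y]} Z`. -/
def Metric.curvatureCoeff {m : ℕ} (g : Metric m) (a b c d : Fin m) (x : Fin m → ℝ) : ℝ :=
  pd c (g.christoffel a d b) x - pd d (g.christoffel a c b) x
    + ∑ e, (g.christoffel a c e x * g.christoffel e d b x
      - g.christoffel a d e x * g.christoffel e c b x)

/-- The curvature operator `R(X, Y) Z` at `x`. -/
def Metric.curvature {m : ℕ} (g : Metric m) (x X Y Z : Fin m → ℝ) : Fin m → ℝ :=
  fun a => ∑ b, ∑ c, ∑ d, g.curvatureCoeff a b c d x * Z b * X c * Y d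

/-- The vector field `dφ(∂ᵢ)` along `φ`. -/
def dmap {m n : ℕ} (φ : (Fin m → ℝ) → (Fin n → ℝ)) (i : Fin m) (x : Fin m → ℝ) : Fin n → ℝ :=
  fun a => pd i (fun y => φ y a) x

/-- The pull-back metric `φ* h`. -/
def pullback {m n : ℕ} (h : Metric n) (φ : (Fin m → ℝ) → (Fin n → ℝ)) : Metric m :=
  fun x => Matrix.of fun i j => h.ip (φ x) (dmap φ i x) (dmap φ j x)

/-- The pull-back connection `∇^φ_{∂ᵢ} V` applied to a vector field `V` along `φ`. -/
def pullbackConn {m n : ℕ} (h : Metric n) (φ : (Fin m → ℝ) → (Fin n → ℝ)) (i : Fin m)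
    (V : (Fin m → ℝ) → (Fin n → ℝ)) (x : Fin m → ℝ) : Fin n → ℝ :=
  fun a => pd i (fun y => V y a) x
    + ∑ b, ∑ c, h.christoffel a b c (φ x) * dmap φ i x b * V x c

/-- The tension field `τ(φ) = Trace_g ∇dφ` of `φ : (U, g) → (N, h)`, where
`∇dφ(∂ᵢ, ∂ⱼ) = ∇^φ_{∂ᵢ} dφ(∂ⱼ) - dφ(∇_{∂ᵢ} ∂ⱼ)`. -/
def tension {m n : ℕ} (g : Metric m) (h : Metric n) (φ : (Fin m → ℝ) → (Fin n → ℝ))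
    (x : Fin m → ℝ) : Fin n → ℝ :=
  ∑ i, ∑ j, (g x)⁻¹ i j •
    (pullbackConn h φ i (dmap φ j) x - ∑ k, g.christoffel k i j x • dmap φ k x)

/-- The bitension field
`τ₂(φ) = Trace_g (∇^φ ∇^φ - ∇^φ_{∇}) τ(φ) - Trace_g R^N(dφ, τ(φ)) dφ`. -/
def bitension {m n : ℕ} (g : Metric m) (h : Metric n) (φ : (Fin m → ℝ) → (Fin n → ℝ))
    (x : Fin m → ℝ) : Fin n → ℝ :=
  (∑ i, ∑ j, (g x)⁻¹ i j •
    (pullbackConn h φ i (pullbackConn h φ j (tension g h φ)) x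
      - ∑ k, g.christoffel k i j x • pullbackConn h φ k (tension g h φ) x))
  - ∑ i, ∑ j, (g x)⁻¹ i j • h.curvature (φ x) (dmap φ i x) (tension g h φ x) (dmap φ j x)

/-- The (smooth) map `φ : (U, g) → (N, h)` is harmonic: `τ(φ) = 0`. -/
def IsHarmonicOn {m n : ℕ} (g : Metric m) (h : Metric n) (φ : (Fin m → ℝ) → (Fin n → ℝ))
    (U : Set (Fin m → ℝ)) : Prop :=
  ∀ x ∈ U, tension g h φ x = 0

/-- The (smooth) map `φ : (U, g) → (N, h)` is biharmonic: `τ₂(φ) = 0`. -/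
def IsBiharmonicOn {m n : ℕ} (g : Metric m) (h : Metric n) (φ : (Fin m → ℝ) → (Fin n → ℝ))
    (U : Set (Fin m → ℝ)) : Prop :=
  ∀ x ∈ U, bitension g h φ x = 0

/-- Proper biharmonic: biharmonic and not harmonic. -/
def IsProperBiharmonicOn {m n : ℕ} (g : Metric m) (h : Metric n)
    (φ : (Fin m → ℝ) → (Fin n → ℝ)) (U : Set (Fin m → ℝ)) : Prop :=
  IsBiharmonicOn g h φ U ∧ ¬ IsHarmonicOn g h φ U

/-- `φ : (U, g) → (N, h)` is a conformal immersion with conformal factor `lam > 0`: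
`φ* h = lam² g` on `U`. -/
def HasConformalFactorOn {m n : ℕ} (g : Metric m) (h : Metric n)
    (φ : (Fin m → ℝ) → (Fin n → ℝ)) (lam : (Fin m → ℝ) → ℝ) (U : Set (Fin m → ℝ)) : Prop :=
  ∀ x ∈ U, 0 < lam x ∧ pullback h φ x = lam x ^ 2 • g x

/-- `ξ` is a field of unit normal vectors along the hypersurface `φ : U → (N, h)`. -/
def IsUnitNormalOn {m n : ℕ} (h : Metric n) (φ ξ : (Fin m → ℝ) → (Fin n → ℝ))
    (U : Set (Fin m → ℝ)) : Prop :=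
  ∀ x ∈ U, h.ip (φ x) (ξ x) (ξ x) = 1 ∧ ∀ i, h.ip (φ x) (ξ x) (dmap φ i x) = 0

/-- The mean curvature vector field `η = (1/m) Trace_g ∇dφ`, `g = φ* h`, of the isometric immersion
`φ : (U, φ* h) → (N, h)`. -/
def meanCurvatureVector {m n : ℕ} (h : Metric n) (φ : (Fin m → ℝ) → (Fin n → ℝ))
    (x : Fin m → ℝ) : Fin n → ℝ :=
  (1 / (m : ℝ)) • tension (pullback h φ) h φ x

/-- `H` is the mean curvature of `φ : (U, φ* h) → (N, h)` with respect to the unit normal field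
`ξ`, that is, `η = H ξ`. -/
def HasMeanCurvatureOn {m n : ℕ} (h : Metric n) (φ ξ : (Fin m → ℝ) → (Fin n → ℝ))
    (H : (Fin m → ℝ) → ℝ) (U : Set (Fin m → ℝ)) : Prop :=
  IsUnitNormalOn h φ ξ U ∧ ∀ x ∈ U, meanCurvatureVector h φ x = H x • ξ x

/-- The metric `β(z)⁻² (dx² + dy² + dz²)` in dimension three. -/
def confMetric (β : ℝ → ℝ) : Metric 3 :=
  fun q => (β (q 2) ^ 2)⁻¹ • (1 : Matrix (Fin 3) (Fin 3) ℝ)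

/-- The height `z = a₁ x + a₂ y + a₃` of the plane over the point `(x, y)`. -/
def planeHeight (a₁ a₂ a₃ : ℝ) (p : Fin 2 → ℝ) : ℝ := a₁ * p 0 + a₂ * p 1 + a₃

/-- The parametrization `(x, y) ↦ (x, y, a₁ x + a₂ y + a₃)` of the plane. -/
def planeMap (a₁ a₂ a₃ : ℝ) (p : Fin 2 → ℝ) : Fin 3 → ℝ := ![p 0, p 1, planeHeight a₁ a₂ a₃ p]

/-- The upward unit normal `β(z) (-a₁, -a₂, 1) / √(1 + a₁² + a₂²)` of the plane with respect to
`confMetric β`. -/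
def planeNormal (β : ℝ → ℝ) (a₁ a₂ a₃ : ℝ) (p : Fin 2 → ℝ) : Fin 3 → ℝ :=
  (β (planeHeight a₁ a₂ a₃ p) / √(1 + a₁ ^ 2 + a₂ ^ 2)) • ![-a₁, -a₂, 1]

/-- The metric `f⁻¹ φ* h` on the plane, where `h = confMetric β` and `φ` is `planeMap`. -/
def planeMetric (β : ℝ → ℝ) (a₁ a₂ a₃ : ℝ) (f : (Fin 2 → ℝ) → ℝ) : Metric 2 :=
  fun p => (f p)⁻¹ • pullback (confMetric β) (planeMap a₁ a₂ a₃) p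

end CoordGeom

end

/-! Put `s = 1 + a₁² + a₂²`, `n = (-a₁, -a₂, 1)` and `P = (2/s) f β'(z)` (`planeTension`). The
domain metric is a function times a constant matrix in dimension two, so its traced Christoffel
symbols vanish and every trace uses plain coordinate derivatives. This gives `τ = β P n`
(`tension_planeMap`), and a second differentiation gives (`bitension_planeMap`) `τ₂ = f β² ((β ΔP +
((s + 1)/s) ((β β'' - 2 β'²)/β) P) n - 2 β' grad P)`, with Euclidean `Δ` and `grad` on the plane.

Normal and tangential parts vanish separately (`smul_normal_sub_tangent_eq_zero`). As `P` is a
multiple of `β'`, the tangential equation `β' grad P = 0` makes `P²` constant on the connected set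
`U`. If the map is not harmonic, this constant is nonzero, so `β'` never vanishes and `grad P = 0`;
the normal equation then becomes `β β'' - 2 β'² = 0`, and constancy of `|P|` is the formula for `f`.
These steps reverse. The mean curvature is the case `f = 1` of the tension formula. -/

open Topology

noncomputable section

namespace CoordGeom

/-! ### Calculus of coordinate partial derivatives. -/

section PartialDerivatives

variable {m : ℕ} {i : Fin m} {F G : (Fin m → ℝ) → ℝ} {x : Fin m → ℝ}

lemma pd_congr (hFG : F =ᶠ[𝓝 x] G) : pd i F x = pd i G x := by
  unfold pd; rw [hFG.fderiv_eq]

lemma pd_const (c : ℝ) : pd i (fun _ => c) x = 0 := by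
  simp [pd]

lemma pd_add (hF : DifferentiableAt ℝ F x) (hG : DifferentiableAt ℝ G x) :
    pd i (fun y => F y + G y) x = pd i F x + pd i G x := by
  simp [pd, fderiv_fun_add hF hG]

lemma pd_mul (hF : DifferentiableAt ℝ F x) (hG : DifferentiableAt ℝ G x) :
    pd i (fun y => F y * G y) x = F x * pd i G x + G x * pd i F x := by
  simp [pd, fderiv_fun_mul hF hG]

lemma pd_mul_const (hF : DifferentiableAt ℝ F x) (c : ℝ) :
    pd i (fun y => F y * c) x = pd i F x * c := by
  rw [pd_mul hF (differentiableAt_const c), pd_const]; ring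

lemma pd_comp {γ : ℝ → ℝ} (hγ : DifferentiableAt ℝ γ (F x)) (hF : DifferentiableAt ℝ F x) :
    pd i (fun y => γ (F y)) x = deriv γ (F x) * pd i F x := by
  have h := (hγ.hasDerivAt.comp_hasFDerivAt x hF.hasFDerivAt).fderiv
  have h' : fderiv ℝ (fun y => γ (F y)) x = deriv γ (F x) • fderiv ℝ F x := h
  simp [pd, h']

lemma pd_proj (j : Fin m) : pd i (fun y => y j) x = if j = i then 1 else 0 := by
  have h : fderiv ℝ (fun y : Fin m → ℝ => y j) x = ContinuousLinearMap.proj (R := ℝ) j :=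
    (ContinuousLinearMap.proj (R := ℝ) (φ := fun _ : Fin m => ℝ) j).fderiv
  simp [pd, h, Pi.single_apply]

lemma fderiv_eq_zero_of_pd (h : ∀ i, pd i F x = 0) : fderiv ℝ F x = 0 := by
  apply ContinuousLinearMap.coe_injective
  refine LinearMap.pi_ext' fun i => LinearMap.ext_ring ?_
  simpa [pd] using h i

end PartialDerivatives

/-- In dimension `m` the trace of the Christoffel symbols of `G • S` is a multiple of `(2 - m) S⁻¹
∇G`, which is zero for `m = 2`: linear coordinates are harmonic for every metric conformal to a
constant one. -/
lemma sum_inv_mul_christoffel_eq_zero {g : Metric 2} {G : (Fin 2 → ℝ) → ℝ}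
    {S : Matrix (Fin 2) (Fin 2) ℝ} {x : Fin 2 → ℝ} (hg : g =ᶠ[𝓝 x] fun y => G y • S)
    (hG : DifferentiableAt ℝ G x) (hGx : G x ≠ 0) (hS : S 0 1 = S 1 0) (hdet : S.det ≠ 0)
    (k : Fin 2) : ∑ i, ∑ j, (g x)⁻¹ i j * g.christoffel k i j x = 0 := by
  have hpd : ∀ i j l, pd i (fun y => g y j l) x = pd i G x * S j l := fun i j l => by
    rw [← pd_mul_const hG]
    exact pd_congr (hg.mono fun y hy => by simp [hy])
  have hinv : (g x)⁻¹ = (G x)⁻¹ • (S.det⁻¹ • !![S 1 1, -S 0 1; -S 1 0, S 0 0]) := by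
    rw [hg.self_of_nhds]
    apply Matrix.inv_eq_right_inv
    have hD := S.det_fin_two
    generalize S.det = D at hD hdet
    ext i j
    fin_cases i <;> fin_cases j <;> simp [Matrix.mul_apply, Fin.sum_univ_two] <;>
      field_simp <;> linarith
  simp only [Metric.christoffel, hpd, hinv, Fin.sum_univ_two]
  fin_cases k <;> simp [hS] <;> ring

section Trace

variable {n : ℕ} {g : Metric 2} (h : Metric n) (φ : (Fin 2 → ℝ) → (Fin n → ℝ))
  {x : Fin 2 → ℝ}

lemma sum_smul_sub_christoffel
    (hg : ∀ k, ∑ i, ∑ j, (g x)⁻¹ i j * g.christoffel k i j x = 0)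
    (A : Fin 2 → Fin 2 → Fin n → ℝ) (V : Fin 2 → Fin n → ℝ) :
    ∑ i, ∑ j, (g x)⁻¹ i j • (A i j - ∑ k, g.christoffel k i j x • V k) =
      ∑ i, ∑ j, (g x)⁻¹ i j • A i j := by
  have h0 := hg 0
  have h1 := hg 1
  ext a
  simp only [Fin.sum_univ_two, Pi.add_apply, Pi.smul_apply, Pi.sub_apply, smul_eq_mul] at *
  linear_combination -V 0 a * h0 - V 1 a * h1

lemma pullbackConn_congr {m : ℕ} {φ : (Fin m → ℝ) → (Fin n → ℝ)} {x : Fin m → ℝ} {i : Fin m}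
    {V W : (Fin m → ℝ) → (Fin n → ℝ)}
    (hVW : V =ᶠ[𝓝 x] W) : pullbackConn h φ i V x = pullbackConn h φ i W x := by
  ext a
  simp only [pullbackConn]
  rw [pd_congr (hVW.mono fun y hy => by rw [hy]), hVW.self_of_nhds]

end Trace

/-! ### Connection and curvature of the conformally flat ambient metric. -/

section Conformal

/-- The Christoffel symbols of `confMetric β`, divided by the logarithmic derivative of the
conformal factor `β⁻¹`. -/
def confSymbol (k i j : Fin 3) : ℝ :=
  (if k = j ∧ i = 2 then 1 else 0) + (if k = i ∧ j = 2 then 1 else 0)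
    - (if i = j ∧ k = 2 then 1 else 0)

variable {β : ℝ → ℝ} {q : Fin 3 → ℝ}

lemma pd_comp_proj {γ : ℝ → ℝ} (hγ : DifferentiableAt ℝ γ (q 2)) (i : Fin 3) :
    pd i (fun y => γ (y 2)) q = deriv γ (q 2) * if i = 2 then 1 else 0 := by
  rw [pd_comp (F := fun y : Fin 3 → ℝ => y 2) hγ (by fun_prop), pd_proj]
  simp [eq_comm]

/-- The metric is `e^{2u}` times the Euclidean one with `u = -log β`, so this is the conformal
change formula `Γᵏᵢⱼ = δₖⱼ ∂ᵢu + δₖᵢ ∂ⱼu - δᵢⱼ ∂ₖu` with `∂ᵢu = -(β'/β) δᵢ₂`. -/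
lemma christoffel_confMetric (hβ : DifferentiableAt ℝ β (q 2)) (h0 : β (q 2) ≠ 0)
    (k i j : Fin 3) :
    (confMetric β).christoffel k i j q = -(deriv β (q 2) / β (q 2)) * confSymbol k i j := by
  have hd : DifferentiableAt ℝ (fun z => (β z ^ 2)⁻¹) (q 2) := (hβ.pow 2).inv (pow_ne_zero 2 h0)
  have hder : deriv (fun z => (β z ^ 2)⁻¹) (q 2) = -2 * deriv β (q 2) / β (q 2) ^ 3 := by
    have := ((hβ.hasDerivAt.pow 2).inv (pow_ne_zero 2 h0)).deriv
    refine Eq.trans this ?_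
    simp only [Pi.pow_apply, Nat.cast_ofNat]
    field_simp
    ring
  have hpd : ∀ i j l, pd i (fun y => confMetric β y j l) q =
      -2 * deriv β (q 2) / β (q 2) ^ 3 * (if i = 2 then 1 else 0) *
        (1 : Matrix (Fin 3) (Fin 3) ℝ) j l := fun i j l => by
    rw [← hder, ← pd_comp_proj hd, ← pd_mul_const]
    · rfl
    · exact DifferentiableAt.comp q (f := fun y : Fin 3 → ℝ => y 2) hd (by fun_prop)
  have hinv : (confMetric β q)⁻¹ = (β (q 2) ^ 2) • (1 : Matrix (Fin 3) (Fin 3) ℝ) := by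
    apply Matrix.inv_eq_right_inv
    simp [confMetric, smul_smul, h0]
  simp only [Metric.christoffel, hpd, hinv, Fin.sum_univ_three, confSymbol]
  fin_cases k <;> fin_cases i <;> fin_cases j <;> simp [Matrix.one_apply] <;> field_simp

/-- The Christoffel symbols are `-β'/β` times constants: the first term differentiates this factor,
the second is quadratic in it. Differentiability of `β` is needed near `q 2`, since the formula for
the symbols is itself differentiated. -/
lemma curvatureCoeff_confMetric (hβ : ∀ᶠ z in 𝓝 (q 2), DifferentiableAt ℝ β z)
    (hβ' : DifferentiableAt ℝ (deriv β) (q 2)) (h0 : β (q 2) ≠ 0) (a b c d : Fin 3) :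
    (confMetric β).curvatureCoeff a b c d q =
      -((deriv (deriv β) (q 2) * β (q 2) - deriv β (q 2) ^ 2) / β (q 2) ^ 2) *
        ((if c = 2 then 1 else 0) * confSymbol a d b - (if d = 2 then 1 else 0) * confSymbol a c b)
      + (deriv β (q 2) / β (q 2)) ^ 2 * ∑ e, (confSymbol a c e * confSymbol e d b
        - confSymbol a d e * confSymbol e c b) := by
  have hβq := hβ.self_of_nhds
  have hd : DifferentiableAt ℝ (fun z => -(deriv β z / β z)) (q 2) := (hβ'.div hβq h0).neg
  have hder : deriv (fun z => -(deriv β z / β z)) (q 2) =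
      -((deriv (deriv β) (q 2) * β (q 2) - deriv β (q 2) ^ 2) / β (q 2) ^ 2) := by
    have := ((hβ'.hasDerivAt.div hβq.hasDerivAt h0).neg).deriv
    refine Eq.trans this ?_
    ring
  have hev : ∀ᶠ y : Fin 3 → ℝ in 𝓝 q, DifferentiableAt ℝ β (y 2) ∧ β (y 2) ≠ 0 :=
    (continuous_apply (2 : Fin 3)).continuousAt.eventually
      (hβ.and (hβq.continuousAt.eventually_ne h0))
  have hpd : ∀ k i j l, pd l ((confMetric β).christoffel k i j) q =
      -((deriv (deriv β) (q 2) * β (q 2) - deriv β (q 2) ^ 2) / β (q 2) ^ 2) *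
        (if l = 2 then 1 else 0) * confSymbol k i j := fun k i j l => by
    rw [← hder, ← pd_comp_proj hd, ← pd_mul_const]
    · exact pd_congr (hev.mono fun y hy => christoffel_confMetric hy.1 hy.2 k i j)
    · exact DifferentiableAt.comp q (f := fun y : Fin 3 → ℝ => y 2) hd (by fun_prop)
  simp only [Metric.curvatureCoeff, hpd, christoffel_confMetric hβq h0, Fin.sum_univ_three]
  ring

end Conformal

/-! ### Geometry of the plane and its tension field. -/

section Plane

variable (a₁ a₂ a₃ : ℝ)

/-- The coordinate tangent vectors of the plane `z = a₁ x + a₂ y + a₃`. -/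
def planeTangent (i : Fin 2) : Fin 3 → ℝ := ![![1, 0, a₁], ![0, 1, a₂]] i

/-- The Euclidean first fundamental form of the plane `z = a₁ x + a₂ y + a₃`. -/
def planeGram : Matrix (Fin 2) (Fin 2) ℝ := !![1 + a₁ ^ 2, a₁ * a₂; a₁ * a₂, 1 + a₂ ^ 2]

/-- The inverse of the Euclidean first fundamental form of the plane. -/
def planeGramInv : Matrix (Fin 2) (Fin 2) ℝ :=
  (1 + a₁ ^ 2 + a₂ ^ 2)⁻¹ • !![1 + a₂ ^ 2, -(a₁ * a₂); -(a₁ * a₂), 1 + a₁ ^ 2]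

/-- The covariant derivative, for `confMetric β` with `β' / β = 1` and up to sign, of the constant
vector field `w` along the plane in the direction of the `i`-th coordinate. -/
def planeConn (i : Fin 2) (w : Fin 3 → ℝ) : Fin 3 → ℝ :=
  ![a₁, a₂] i • w + w 2 • planeTangent a₁ a₂ i
    - (∑ b, planeTangent a₁ a₂ i b * w b) • ![0, 0, 1]

lemma planeSq_pos : 0 < 1 + a₁ ^ 2 + a₂ ^ 2 := by positivity

lemma differentiable_planeHeight : Differentiable ℝ (planeHeight a₁ a₂ a₃) := by
  unfold planeHeight; fun_prop

lemma contDiff_planeHeight : ContDiff ℝ ∞ (planeHeight a₁ a₂ a₃) := by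
  unfold planeHeight; fun_prop

lemma pd_planeHeight (i : Fin 2) (p : Fin 2 → ℝ) :
    pd i (planeHeight a₁ a₂ a₃) p = ![a₁, a₂] i := by
  have : planeHeight a₁ a₂ a₃ = fun y => (y 0 * a₁ + y 1 * a₂) + a₃ := by
    ext y; simp only [planeHeight]; ring
  rw [this, pd_add (by fun_prop) (by fun_prop), pd_add (by fun_prop) (by fun_prop), pd_const,
    pd_mul_const (by fun_prop), pd_mul_const (by fun_prop), pd_proj, pd_proj]
  fin_cases i <;> simp

lemma pd_comp_planeHeight {γ : ℝ → ℝ} {p : Fin 2 → ℝ}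
    (hγ : DifferentiableAt ℝ γ (planeHeight a₁ a₂ a₃ p)) (i : Fin 2) :
    pd i (fun y => γ (planeHeight a₁ a₂ a₃ y)) p =
      deriv γ (planeHeight a₁ a₂ a₃ p) * ![a₁, a₂] i := by
  rw [pd_comp hγ (differentiable_planeHeight a₁ a₂ a₃ p), pd_planeHeight]

lemma dmap_planeMap (i : Fin 2) (p : Fin 2 → ℝ) :
    dmap (planeMap a₁ a₂ a₃) i p = planeTangent a₁ a₂ i := by
  ext a
  fin_cases a
  · simp only [dmap, planeMap, planeTangent]
    refine (pd_proj 0).trans ?_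
    fin_cases i <;> simp
  · simp only [dmap, planeMap, planeTangent]
    refine (pd_proj 1).trans ?_
    fin_cases i <;> simp
  · simp only [dmap, planeMap, planeTangent]
    refine (pd_planeHeight a₁ a₂ a₃ i p).trans ?_
    fin_cases i <;> simp

variable {β : ℝ → ℝ} {f : (Fin 2 → ℝ) → ℝ} {p : Fin 2 → ℝ}

lemma pullback_confMetric_planeMap (p : Fin 2 → ℝ) :
    pullback (confMetric β) (planeMap a₁ a₂ a₃) p =
      (β (planeHeight a₁ a₂ a₃ p) ^ 2)⁻¹ • planeGram a₁ a₂ := by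
  ext i j
  simp only [pullback, dmap_planeMap, Metric.ip, confMetric, Fin.sum_univ_three]
  fin_cases i <;> fin_cases j <;>
    simp [planeTangent, planeGram, planeMap] <;> ring

lemma planeMetric_eq (p : Fin 2 → ℝ) : planeMetric β a₁ a₂ a₃ f p =
    ((f p)⁻¹ * (β (planeHeight a₁ a₂ a₃ p) ^ 2)⁻¹) • planeGram a₁ a₂ := by
  rw [planeMetric, pullback_confMetric_planeMap, smul_smul]

lemma det_planeGram : (planeGram a₁ a₂).det = 1 + a₁ ^ 2 + a₂ ^ 2 := by
  simp [planeGram, Matrix.det_fin_two]; ring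

lemma planeMetric_inv (hf : f p ≠ 0) (h0 : β (planeHeight a₁ a₂ a₃ p) ≠ 0) :
    (planeMetric β a₁ a₂ a₃ f p)⁻¹ =
      (f p * β (planeHeight a₁ a₂ a₃ p) ^ 2) • planeGramInv a₁ a₂ := by
  have hs := (planeSq_pos a₁ a₂).ne'
  rw [planeMetric_eq]
  apply Matrix.inv_eq_right_inv
  ext i j
  fin_cases i <;> fin_cases j <;>
    simp [planeGram, planeGramInv, Matrix.mul_apply, Fin.sum_univ_two] <;> field_simp <;> ring

lemma sum_inv_mul_christoffel_planeMetric (hfd : DifferentiableAt ℝ f p) (hf : f p ≠ 0)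
    (hβ : DifferentiableAt ℝ β (planeHeight a₁ a₂ a₃ p))
    (h0 : β (planeHeight a₁ a₂ a₃ p) ≠ 0) (k : Fin 2) :
    ∑ i, ∑ j, (planeMetric β a₁ a₂ a₃ f p)⁻¹ i j *
      (planeMetric β a₁ a₂ a₃ f).christoffel k i j p = 0 := by
  refine sum_inv_mul_christoffel_eq_zero (S := planeGram a₁ a₂)
    (Filter.Eventually.of_forall fun y => planeMetric_eq a₁ a₂ a₃ y) ?_ ?_ rfl ?_ k
  · have : DifferentiableAt ℝ (fun y => β (planeHeight a₁ a₂ a₃ y)) p :=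
      hβ.comp p (differentiable_planeHeight a₁ a₂ a₃ p)
    exact (hfd.inv hf).mul ((this.pow 2).inv (pow_ne_zero 2 h0))
  · positivity
  · rw [det_planeGram]; exact (planeSq_pos a₁ a₂).ne'

/-- Two constant vectors suffice: the derivatives of the tension field are combinations of the
normal `n` and one tangent vector. -/
lemma pullbackConn_planeMap (hβ : DifferentiableAt ℝ β (planeHeight a₁ a₂ a₃ p))
    (h0 : β (planeHeight a₁ a₂ a₃ p) ≠ 0) {A B : (Fin 2 → ℝ) → ℝ}
    (hA : DifferentiableAt ℝ A p) (hB : DifferentiableAt ℝ B p) (v w : Fin 3 → ℝ) (i : Fin 2) :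
    pullbackConn (confMetric β) (planeMap a₁ a₂ a₃) i (fun y => A y • v + B y • w) p =
      pd i A p • v + pd i B p • w
        - (deriv β (planeHeight a₁ a₂ a₃ p) / β (planeHeight a₁ a₂ a₃ p)) •
          (A p • planeConn a₁ a₂ i v + B p • planeConn a₁ a₂ i w) := by
  have hpd : ∀ a, pd i (fun y => A y * v a + B y * w a) p = pd i A p * v a + pd i B p * w a :=
    fun a => by
      rw [pd_add (hA.mul_const _) (hB.mul_const _), pd_mul_const hA, pd_mul_const hB]
  have hΓ : ∀ a b c, (confMetric β).christoffel a b c (planeMap a₁ a₂ a₃ p) =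
      -(deriv β (planeHeight a₁ a₂ a₃ p) / β (planeHeight a₁ a₂ a₃ p)) * confSymbol a b c :=
    christoffel_confMetric (q := planeMap a₁ a₂ a₃ p) hβ h0
  ext a
  simp only [pullbackConn, hΓ, dmap_planeMap, Fin.sum_univ_three, planeConn, confSymbol,
    Pi.add_apply, Pi.sub_apply, Pi.smul_apply, smul_eq_mul, hpd]
  generalize deriv β (planeHeight a₁ a₂ a₃ p) / β (planeHeight a₁ a₂ a₃ p) = u
  fin_cases a <;> fin_cases i <;> simp [planeTangent] <;> ring

lemma pullbackConn_planeMap_smul (hβ : DifferentiableAt ℝ β (planeHeight a₁ a₂ a₃ p))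
    (h0 : β (planeHeight a₁ a₂ a₃ p) ≠ 0) {A : (Fin 2 → ℝ) → ℝ}
    (hA : DifferentiableAt ℝ A p) (v : Fin 3 → ℝ) (i : Fin 2) :
    pullbackConn (confMetric β) (planeMap a₁ a₂ a₃) i (fun y => A y • v) p =
      pd i A p • v - (deriv β (planeHeight a₁ a₂ a₃ p) / β (planeHeight a₁ a₂ a₃ p)) •
        (A p • planeConn a₁ a₂ i v) := by
  have := pullbackConn_planeMap a₁ a₂ a₃ hβ h0 hA (differentiableAt_const (0 : ℝ)) v 0 i
  simpa [pd_const] using this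

/-- The inner product term in `planeConn` drops out because the normal is Euclidean-orthogonal to
the tangent vectors. -/
lemma planeConn_normal (i : Fin 2) : planeConn a₁ a₂ i ![-a₁, -a₂, 1] =
    ![a₁, a₂] i • ![-a₁, -a₂, 1] + planeTangent a₁ a₂ i := by
  ext a
  fin_cases i <;> fin_cases a <;> simp [planeConn, planeTangent, Fin.sum_univ_three]

/-- The tension field of the plane, in a metric conformal to the induced one. -/
lemma tension_planeMap (hfd : DifferentiableAt ℝ f p) (hf : f p ≠ 0)
    (hβ : DifferentiableAt ℝ β (planeHeight a₁ a₂ a₃ p))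
    (h0 : β (planeHeight a₁ a₂ a₃ p) ≠ 0) :
    tension (planeMetric β a₁ a₂ a₃ f) (confMetric β) (planeMap a₁ a₂ a₃) p =
      (β (planeHeight a₁ a₂ a₃ p) * (2 / (1 + a₁ ^ 2 + a₂ ^ 2) *
        (f p * deriv β (planeHeight a₁ a₂ a₃ p)))) • ![-a₁, -a₂, 1] := by
  have hs := (planeSq_pos a₁ a₂).ne'
  have hd : ∀ i j, pullbackConn (confMetric β) (planeMap a₁ a₂ a₃) i
      (dmap (planeMap a₁ a₂ a₃) j) p =
      -(deriv β (planeHeight a₁ a₂ a₃ p) / β (planeHeight a₁ a₂ a₃ p)) •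
        planeConn a₁ a₂ i (planeTangent a₁ a₂ j) := fun i j => by
    have : dmap (planeMap a₁ a₂ a₃) j = fun _ => (1 : ℝ) • planeTangent a₁ a₂ j := by
      ext1 y; rw [dmap_planeMap, one_smul]
    rw [this, pullbackConn_planeMap_smul a₁ a₂ a₃ hβ h0 (differentiableAt_const _), pd_const]
    simp
  rw [tension, sum_smul_sub_christoffel
    (sum_inv_mul_christoffel_planeMetric a₁ a₂ a₃ hfd hf hβ h0)]
  simp only [hd, planeMetric_inv a₁ a₂ a₃ hf h0, Fin.sum_univ_two, planeGramInv]
  generalize deriv β (planeHeight a₁ a₂ a₃ p) = β'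
  ext a
  fin_cases a <;> simp [planeConn, planeTangent, Fin.sum_univ_three] <;> field_simp <;> ring

/-- The trace of the curvature term in the bitension field of the plane. -/
lemma sum_curvature_planeMap (hβ : ∀ᶠ z in 𝓝 (planeHeight a₁ a₂ a₃ p), DifferentiableAt ℝ β z)
    (hβ' : DifferentiableAt ℝ (deriv β) (planeHeight a₁ a₂ a₃ p))
    (h0 : β (planeHeight a₁ a₂ a₃ p) ≠ 0) (t : ℝ) :
    ∑ i, ∑ j, planeGramInv a₁ a₂ i j • (confMetric β).curvature (planeMap a₁ a₂ a₃ p)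
        (planeTangent a₁ a₂ i) (t • ![-a₁, -a₂, 1]) (planeTangent a₁ a₂ j) =
      -(t / (1 + a₁ ^ 2 + a₂ ^ 2)) • ((((a₁ ^ 2 + a₂ ^ 2) * (β (planeHeight a₁ a₂ a₃ p) *
          deriv (deriv β) (planeHeight a₁ a₂ a₃ p) - 2 * deriv β (planeHeight a₁ a₂ a₃ p) ^ 2) +
          2 * β (planeHeight a₁ a₂ a₃ p) * deriv (deriv β) (planeHeight a₁ a₂ a₃ p) -
          2 * deriv β (planeHeight a₁ a₂ a₃ p) ^ 2) / β (planeHeight a₁ a₂ a₃ p) ^ 2) •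
            ![-a₁, -a₂, 1] +
        (deriv (deriv β) (planeHeight a₁ a₂ a₃ p) / β (planeHeight a₁ a₂ a₃ p)) •
            ![a₁, a₂, a₁ ^ 2 + a₂ ^ 2]) := by
  have hs := (planeSq_pos a₁ a₂).ne'
  have hR := curvatureCoeff_confMetric (q := planeMap a₁ a₂ a₃ p) hβ hβ' h0
  have hz : planeMap a₁ a₂ a₃ p 2 = planeHeight a₁ a₂ a₃ p := rfl
  simp only [hz] at hR
  ext a
  simp only [Finset.sum_apply, Pi.add_apply, Pi.smul_apply, Metric.curvature, hR, Fin.sum_univ_two,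
    Fin.sum_univ_three, planeGramInv, confSymbol]
  generalize deriv (deriv β) (planeHeight a₁ a₂ a₃ p) = β''
  generalize deriv β (planeHeight a₁ a₂ a₃ p) = β'
  generalize β (planeHeight a₁ a₂ a₃ p) = b at *
  fin_cases a <;> simp [planeTangent] <;> field_simp <;> ring

end Plane

/-! ### The bitension field of the plane. -/

lemma contDiffOn_pd {m : ℕ} {F : (Fin m → ℝ) → ℝ} {U : Set (Fin m → ℝ)} (hU : IsOpen U)
    (hF : ContDiffOn ℝ ∞ F U) (i : Fin m) : ContDiffOn ℝ ∞ (pd i F) U :=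
  (hF.fderiv_of_isOpen hU (m := ∞) (by simp)).clm_apply contDiffOn_const

section Bitension

variable (a₁ a₂ a₃ : ℝ)

/-- The normal component of the tension field of the plane, divided by `β`. -/
def planeTension (β : ℝ → ℝ) (f : (Fin 2 → ℝ) → ℝ) (p : Fin 2 → ℝ) : ℝ :=
  2 / (1 + a₁ ^ 2 + a₂ ^ 2) * (f p * deriv β (planeHeight a₁ a₂ a₃ p))

variable {a₁ a₂ a₃} {β : ℝ → ℝ} {f : (Fin 2 → ℝ) → ℝ} {J : Set ℝ} {U : Set (Fin 2 → ℝ)}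
  {p : Fin 2 → ℝ}

lemma contDiffOn_planeTension (hJ : IsOpen J) (hβ : ContDiffOn ℝ ∞ β J)
    (hUJ : ∀ p ∈ U, planeHeight a₁ a₂ a₃ p ∈ J) (hf : ContDiffOn ℝ ∞ f U) :
    ContDiffOn ℝ ∞ (planeTension a₁ a₂ a₃ β f) U :=
  contDiffOn_const.mul (hf.mul ((hβ.deriv_of_isOpen hJ (m := ∞) (by simp)).comp
    (contDiff_planeHeight a₁ a₂ a₃).contDiffOn hUJ))

/-- The bitension field of the plane, in a metric conformal to the induced one. -/
lemma bitension_planeMap (hJ : IsOpen J) (hβ : ContDiffOn ℝ ∞ β J) (hβpos : ∀ z ∈ J, 0 < β z)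
    (hU : IsOpen U) (hUJ : ∀ p ∈ U, planeHeight a₁ a₂ a₃ p ∈ J)
    (hf : ContDiffOn ℝ ∞ f U) (hfpos : ∀ p ∈ U, 0 < f p) (hp : p ∈ U) :
    bitension (planeMetric β a₁ a₂ a₃ f) (confMetric β) (planeMap a₁ a₂ a₃) p =
      (f p * β (planeHeight a₁ a₂ a₃ p) ^ 2) •
        ((β (planeHeight a₁ a₂ a₃ p) *
            ∑ i, ∑ j, planeGramInv a₁ a₂ i j * pd i (pd j (planeTension a₁ a₂ a₃ β f)) p +
          (2 + a₁ ^ 2 + a₂ ^ 2) / (1 + a₁ ^ 2 + a₂ ^ 2) *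
            (β (planeHeight a₁ a₂ a₃ p) * deriv (deriv β) (planeHeight a₁ a₂ a₃ p)
              - 2 * deriv β (planeHeight a₁ a₂ a₃ p) ^ 2) / β (planeHeight a₁ a₂ a₃ p) *
            planeTension a₁ a₂ a₃ β f p) • ![-a₁, -a₂, 1] -
        (2 * deriv β (planeHeight a₁ a₂ a₃ p)) • ∑ i, ∑ j,
          (planeGramInv a₁ a₂ i j * pd i (planeTension a₁ a₂ a₃ β f) p) •
            planeTangent a₁ a₂ j) := by
  have hβd : ∀ z ∈ J, DifferentiableAt ℝ β z := fun z hz =>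
    (hβ.contDiffAt (hJ.mem_nhds hz)).differentiableAt (by simp)
  have hβ'd : ∀ z ∈ J, DifferentiableAt ℝ (deriv β) z := fun z hz =>
    ((hβ.deriv_of_isOpen hJ (m := ∞) (by simp)).contDiffAt
      (hJ.mem_nhds hz)).differentiableAt (by simp)
  have hfd : ∀ y ∈ U, DifferentiableAt ℝ f y := fun y hy =>
    (hf.contDiffAt (hU.mem_nhds hy)).differentiableAt (by simp)
  have hP := contDiffOn_planeTension hJ hβ hUJ hf
  have hPd : ∀ y ∈ U, DifferentiableAt ℝ (planeTension a₁ a₂ a₃ β f) y := fun y hy =>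
    (hP.contDiffAt (hU.mem_nhds hy)).differentiableAt (by simp)
  have hP'd : ∀ j, ∀ y ∈ U, DifferentiableAt ℝ (pd j (planeTension a₁ a₂ a₃ β f)) y :=
    fun j y hy => ((contDiffOn_pd hU hP j).contDiffAt (hU.mem_nhds hy)).differentiableAt (by simp)
  have hβz : ∀ y ∈ U, DifferentiableAt ℝ (fun y => β (planeHeight a₁ a₂ a₃ y)) y := fun y hy =>
    (hβd _ (hUJ y hy)).comp y (differentiable_planeHeight a₁ a₂ a₃ y)
  have hβ'z : ∀ y ∈ U, DifferentiableAt ℝ (fun y => deriv β (planeHeight a₁ a₂ a₃ y)) y :=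
    fun y hy => (hβ'd _ (hUJ y hy)).comp y (differentiable_planeHeight a₁ a₂ a₃ y)
  have h0 : ∀ y ∈ U, β (planeHeight a₁ a₂ a₃ y) ≠ 0 := fun y hy => (hβpos _ (hUJ y hy)).ne'
  have hτ : ∀ y ∈ U, tension (planeMetric β a₁ a₂ a₃ f) (confMetric β) (planeMap a₁ a₂ a₃) y =
      (β (planeHeight a₁ a₂ a₃ y) * planeTension a₁ a₂ a₃ β f y) • ![-a₁, -a₂, 1] := fun y hy =>
    tension_planeMap a₁ a₂ a₃ (hfd y hy) (hfpos y hy).ne' (hβd _ (hUJ y hy)) (h0 y hy)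
  -- The derivative of the factor `β` cancels the normal part of `planeConn_normal`. The constant
  -- `-1` stands last so that `pd_mul_const` applies in the next differentiation.
  have hD : ∀ j, ∀ y ∈ U, pullbackConn (confMetric β) (planeMap a₁ a₂ a₃) j
      (tension (planeMetric β a₁ a₂ a₃ f) (confMetric β) (planeMap a₁ a₂ a₃)) y =
      (β (planeHeight a₁ a₂ a₃ y) * pd j (planeTension a₁ a₂ a₃ β f) y) • ![-a₁, -a₂, 1] +
        (deriv β (planeHeight a₁ a₂ a₃ y) * planeTension a₁ a₂ a₃ β f y * -1) •
          planeTangent a₁ a₂ j := fun j y hy => by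
    rw [pullbackConn_congr _ (Filter.eventually_of_mem (hU.mem_nhds hy) hτ),
      pullbackConn_planeMap_smul a₁ a₂ a₃ (hβd _ (hUJ y hy)) (h0 y hy)
        ((hβz y hy).fun_mul (hPd y hy)), pd_mul (hβz y hy) (hPd y hy),
      pd_comp_planeHeight _ _ _ (hβd _ (hUJ y hy)), planeConn_normal]
    have := h0 y hy
    ext a
    simp only [Pi.add_apply, Pi.sub_apply, Pi.smul_apply, smul_eq_mul]
    field_simp
    ring
  -- The right-hand side `_` is whatever expression the rewriting produces.
  have hDD : ∀ i j, pullbackConn (confMetric β) (planeMap a₁ a₂ a₃) i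
      (pullbackConn (confMetric β) (planeMap a₁ a₂ a₃) j
        (tension (planeMetric β a₁ a₂ a₃ f) (confMetric β) (planeMap a₁ a₂ a₃))) p = _ :=
    fun i j => by
      rw [pullbackConn_congr _ (Filter.eventually_of_mem (hU.mem_nhds hp) (hD j)),
        pullbackConn_planeMap a₁ a₂ a₃ (hβd _ (hUJ p hp)) (h0 p hp)
          ((hβz p hp).fun_mul (hP'd j p hp)) (((hβ'z p hp).fun_mul (hPd p hp)).mul_const _),
        pd_mul (hβz p hp) (hP'd j p hp), pd_mul_const ((hβ'z p hp).fun_mul (hPd p hp)),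
        pd_mul (hβ'z p hp) (hPd p hp), pd_comp_planeHeight _ _ _ (hβd _ (hUJ p hp)),
        pd_comp_planeHeight _ _ _ (hβ'd _ (hUJ p hp)), planeConn_normal]
  have hinv := planeMetric_inv a₁ a₂ a₃ (f := f) (hfpos p hp).ne' (h0 p hp)
  have hcurv := sum_curvature_planeMap a₁ a₂ a₃ (p := p)
    (Filter.eventually_of_mem (hJ.mem_nhds (hUJ p hp)) hβd) (hβ'd _ (hUJ p hp)) (h0 p hp)
    (β (planeHeight a₁ a₂ a₃ p) * planeTension a₁ a₂ a₃ β f p)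
  rw [bitension, sum_smul_sub_christoffel
    (sum_inv_mul_christoffel_planeMetric a₁ a₂ a₃ (hfd p hp) (hfpos p hp).ne'
      (hβd _ (hUJ p hp)) (h0 p hp)), hτ p hp, hinv]
  simp only [hDD, dmap_planeMap, Matrix.smul_apply, smul_assoc, ← Finset.smul_sum]
  rw [hcurv, ← smul_sub]
  congr 1
  have hb := h0 p hp
  have hs := (planeSq_pos a₁ a₂).ne'
  generalize planeTension a₁ a₂ a₃ β f = P
  generalize deriv (deriv β) (planeHeight a₁ a₂ a₃ p) = β''
  generalize deriv β (planeHeight a₁ a₂ a₃ p) = β'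
  generalize β (planeHeight a₁ a₂ a₃ p) = b at *
  ext a
  fin_cases a <;>
    simp [planeGramInv, planeTangent, planeConn, Fin.sum_univ_two, Fin.sum_univ_three] <;>
    field_simp <;> ring

/-- The normal is Euclidean-orthogonal to the tangent vectors, these are independent, and the
inverse Gram matrix is invertible. -/
lemma smul_normal_sub_tangent_eq_zero {c d : ℝ} {t : Fin 2 → ℝ}
    (h : c • ![-a₁, -a₂, 1] - d • ∑ i, ∑ j,
      (planeGramInv a₁ a₂ i j * t i) • planeTangent a₁ a₂ j = 0) : c = 0 ∧ ∀ i, d * t i = 0 := by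
  have hs := (planeSq_pos a₁ a₂).ne'
  have e0 := congrFun h 0
  have e1 := congrFun h 1
  have e2 := congrFun h 2
  simp [planeGramInv, planeTangent, Fin.sum_univ_two] at e0 e1 e2
  field_simp at e0 e1 e2
  have hc : c = 0 := by
    have : (1 + a₁ ^ 2 + a₂ ^ 2) ^ 2 * c = 0 := by
      -- Euclidean inner product of the equation with the normal.
      linear_combination e2 - a₁ * e0 - a₂ * e1
    simpa [hs] using this
  subst hc
  refine ⟨rfl, fun i => ?_⟩
  -- The first two coordinates of a tangent vector are its coefficients; applying the Gram matrix to
  -- them undoes `planeGramInv`.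
  have h2 : (1 + a₁ ^ 2 + a₂ ^ 2) * (d * t i) = 0 := by
    fin_cases i
    · change (1 + a₁ ^ 2 + a₂ ^ 2) * (d * t 0) = 0
      linear_combination -(1 + a₁ ^ 2) * e0 - a₁ * a₂ * e1
    · change (1 + a₁ ^ 2 + a₂ ^ 2) * (d * t 1) = 0
      linear_combination -(1 + a₂ ^ 2) * e1 - a₁ * a₂ * e0
  simpa [hs] using h2

end Bitension

/-! ### Conformal factor, unit normal and mean curvature. -/

lemma hasConformalFactorOn_planeMetric (a₁ a₂ a₃ : ℝ) (β : ℝ → ℝ) {f : (Fin 2 → ℝ) → ℝ}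
    {U : Set (Fin 2 → ℝ)} (hfpos : ∀ p ∈ U, 0 < f p) :
    HasConformalFactorOn (planeMetric β a₁ a₂ a₃ f) (confMetric β) (planeMap a₁ a₂ a₃)
      (fun p => √(f p)) U := fun p hp => by
  refine ⟨Real.sqrt_pos.2 (hfpos p hp), ?_⟩
  simp only [Real.sq_sqrt (hfpos p hp).le, planeMetric, smul_smul,
    mul_inv_cancel₀ (hfpos p hp).ne', one_smul]

lemma isUnitNormalOn_planeNormal (a₁ a₂ a₃ : ℝ) {β : ℝ → ℝ} {U : Set (Fin 2 → ℝ)}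
    (h0 : ∀ p ∈ U, β (planeHeight a₁ a₂ a₃ p) ≠ 0) :
    IsUnitNormalOn (confMetric β) (planeMap a₁ a₂ a₃) (planeNormal β a₁ a₂ a₃) U := fun p hp => by
  have hb := h0 p hp
  have hs := (planeSq_pos a₁ a₂)
  have hr : √(1 + a₁ ^ 2 + a₂ ^ 2) ^ 2 = 1 + a₁ ^ 2 + a₂ ^ 2 := Real.sq_sqrt hs.le
  have hr0 : √(1 + a₁ ^ 2 + a₂ ^ 2) ≠ 0 := (Real.sqrt_pos.2 hs).ne'
  have hz : planeMap a₁ a₂ a₃ p 2 = planeHeight a₁ a₂ a₃ p := rfl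
  simp only [Metric.ip, dmap_planeMap, confMetric, hz, planeNormal]
  generalize √(1 + a₁ ^ 2 + a₂ ^ 2) = r at *
  constructor
  · simp [Fin.sum_univ_three]
    field_simp
    linear_combination -hr
  · intro i
    fin_cases i <;> simp [Fin.sum_univ_three, planeTangent] <;> ring

lemma hasMeanCurvatureOn_planeMap (a₁ a₂ a₃ : ℝ) {β : ℝ → ℝ} {U : Set (Fin 2 → ℝ)}
    (hβ : ∀ p ∈ U, DifferentiableAt ℝ β (planeHeight a₁ a₂ a₃ p))
    (h0 : ∀ p ∈ U, β (planeHeight a₁ a₂ a₃ p) ≠ 0) :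
    HasMeanCurvatureOn (confMetric β) (planeMap a₁ a₂ a₃) (planeNormal β a₁ a₂ a₃)
      (fun p => deriv β (planeHeight a₁ a₂ a₃ p) / √(1 + a₁ ^ 2 + a₂ ^ 2)) U := by
  refine ⟨isUnitNormalOn_planeNormal a₁ a₂ a₃ h0, fun p hp => ?_⟩
  -- For `f = 1` the domain metric is the induced one, so half the tension field is the mean
  -- curvature vector.
  have hg : pullback (confMetric β) (planeMap a₁ a₂ a₃) =
      planeMetric β a₁ a₂ a₃ (fun _ => 1) := by
    ext1 y; simp [planeMetric]
  rw [meanCurvatureVector, hg, tension_planeMap a₁ a₂ a₃ (differentiableAt_const _) one_ne_zero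
    (hβ p hp) (h0 p hp), planeNormal, smul_smul, smul_smul]
  congr 1
  have hs := (planeSq_pos a₁ a₂)
  have hr : √(1 + a₁ ^ 2 + a₂ ^ 2) ^ 2 = 1 + a₁ ^ 2 + a₂ ^ 2 := Real.sq_sqrt hs.le
  have hr0 : √(1 + a₁ ^ 2 + a₂ ^ 2) ≠ 0 := (Real.sqrt_pos.2 hs).ne'
  rw [← hr]
  simp only [Real.sqrt_sq (Real.sqrt_nonneg _)]
  push_cast
  field_simp

/-! ### Characterization of proper biharmonicity. -/

lemma isProperBiharmonicOn_planeMap_iff {a₁ a₂ a₃ : ℝ} {J : Set ℝ} (hJ : IsOpen J) {β : ℝ → ℝ}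
    (hβ : ContDiffOn ℝ ∞ β J) (hβpos : ∀ z ∈ J, 0 < β z) {U : Set (Fin 2 → ℝ)} (hU : IsOpen U)
    (hUc : IsConnected U) (hUJ : ∀ p ∈ U, planeHeight a₁ a₂ a₃ p ∈ J) {f : (Fin 2 → ℝ) → ℝ}
    (hf : ContDiffOn ℝ ∞ f U) (hfpos : ∀ p ∈ U, 0 < f p) :
    IsProperBiharmonicOn (planeMetric β a₁ a₂ a₃ f) (confMetric β) (planeMap a₁ a₂ a₃) U ↔
      (∀ p ∈ U, β (planeHeight a₁ a₂ a₃ p) * deriv (deriv β) (planeHeight a₁ a₂ a₃ p)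
          - 2 * deriv β (planeHeight a₁ a₂ a₃ p) ^ 2 = 0) ∧
      ∃ c : ℝ, 0 < c ∧ ∀ p ∈ U, deriv β (planeHeight a₁ a₂ a₃ p) ≠ 0 ∧
        f p = c * √(1 + a₁ ^ 2 + a₂ ^ 2) / |deriv β (planeHeight a₁ a₂ a₃ p)| := by
  have hs := planeSq_pos a₁ a₂
  have hr := Real.sqrt_pos.2 hs
  have h0 : ∀ y ∈ U, β (planeHeight a₁ a₂ a₃ y) ≠ 0 := fun y hy => (hβpos _ (hUJ y hy)).ne'
  have hP := contDiffOn_planeTension hJ hβ hUJ hf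
  have hPd : ∀ y ∈ U, DifferentiableAt ℝ (planeTension a₁ a₂ a₃ β f) y := fun y hy =>
    (hP.contDiffAt (hU.mem_nhds hy)).differentiableAt (by simp)
  have hτ : ∀ y ∈ U, tension (planeMetric β a₁ a₂ a₃ f) (confMetric β) (planeMap a₁ a₂ a₃) y =
      (β (planeHeight a₁ a₂ a₃ y) * planeTension a₁ a₂ a₃ β f y) • ![-a₁, -a₂, 1] := fun y hy =>
    tension_planeMap a₁ a₂ a₃ ((hf.contDiffAt (hU.mem_nhds hy)).differentiableAt (by simp))
      (hfpos y hy).ne' ((hβ.contDiffAt (hJ.mem_nhds (hUJ y hy))).differentiableAt (by simp))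
      (h0 y hy)
  have hτ0 : ∀ y ∈ U, tension (planeMetric β a₁ a₂ a₃ f) (confMetric β) (planeMap a₁ a₂ a₃) y = 0
      ↔ planeTension a₁ a₂ a₃ β f y = 0 := fun y hy => by
    rw [hτ y hy, smul_eq_zero, mul_eq_zero]
    have hn : (![-a₁, -a₂, 1] : Fin 3 → ℝ) ≠ 0 := fun h => by simpa using congrFun h 2
    simp [h0 y hy, hn]
  have hP0 : ∀ y ∈ U, planeTension a₁ a₂ a₃ β f y = 0 ↔
      deriv β (planeHeight a₁ a₂ a₃ y) = 0 := fun y hy => by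
    simp [planeTension, hs.ne', (hfpos y hy).ne']
  have hbi := fun p hp => bitension_planeMap hJ hβ hβpos hU hUJ hf hfpos (p := p) hp
  -- Once `P` is nowhere zero with zero gradient, only the normal term without derivatives of `P`
  -- survives, and its other factors are nonzero.
  have hPP : (∀ y ∈ U, planeTension a₁ a₂ a₃ β f y ≠ 0) →
      (∀ y ∈ U, ∀ i, pd i (planeTension a₁ a₂ a₃ β f) y = 0) →
      ∀ y ∈ U, bitension (planeMetric β a₁ a₂ a₃ f) (confMetric β) (planeMap a₁ a₂ a₃) y = 0 ↔
        β (planeHeight a₁ a₂ a₃ y) * deriv (deriv β) (planeHeight a₁ a₂ a₃ y)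
          - 2 * deriv β (planeHeight a₁ a₂ a₃ y) ^ 2 = 0 := fun h1 h2 y hy => by
    have h3 : ∀ i j, pd i (pd j (planeTension a₁ a₂ a₃ β f)) y = 0 := fun i j =>
      (pd_congr (Filter.eventually_of_mem (hU.mem_nhds hy) fun z hz => h2 z hz j)).trans
        (pd_const 0)
    have hn : (![-a₁, -a₂, 1] : Fin 3 → ℝ) ≠ 0 := fun h => by simpa using congrFun h 2
    have hs' : 2 + a₁ ^ 2 + a₂ ^ 2 ≠ 0 := by positivity
    simp only [hbi y hy, h2 y hy, h3, mul_zero, zero_smul, Finset.sum_const_zero, smul_zero,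
      sub_zero, zero_add, smul_eq_zero, mul_eq_zero, div_eq_zero_iff, hn, (hfpos y hy).ne',
      h0 y hy, h1 y hy, hs', hs.ne', or_false, false_or, pow_eq_zero_iff two_ne_zero]
  constructor
  · rintro ⟨hb, hh⟩
    have hb' : ∀ y ∈ U, ∀ i, deriv β (planeHeight a₁ a₂ a₃ y) *
        pd i (planeTension a₁ a₂ a₃ β f) y = 0 := fun y hy i => by
      have h1 := hb y hy
      rw [hbi y hy, smul_eq_zero, or_iff_right (mul_ne_zero (hfpos y hy).ne'
        (pow_ne_zero 2 (h0 y hy)))] at h1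
      have h2 := (smul_normal_sub_tangent_eq_zero h1).2 i
      linear_combination h2 / 2
    -- Using `P²` avoids dividing by `β'`, not yet known to be nonzero: `∂(P²) = 2 P ∂P = (4/s) f
    -- (β' ∂P) = 0`.
    obtain ⟨k, hk⟩ := hU.exists_is_const_of_fderiv_eq_zero (𝕜 := ℝ)
      (f := fun y => planeTension a₁ a₂ a₃ β f y * planeTension a₁ a₂ a₃ β f y)
      hUc.isPreconnected (fun y hy => ((hPd y hy).fun_mul (hPd y hy)).differentiableWithinAt)
      fun y hy => fderiv_eq_zero_of_pd fun i => by
        rw [pd_mul (hPd y hy) (hPd y hy)]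
        simp only [planeTension] at hb' ⊢
        linear_combination (4 / (1 + a₁ ^ 2 + a₂ ^ 2) * f y) * hb' y hy i
    simp only [IsHarmonicOn, not_forall] at hh
    obtain ⟨p₀, hp₀, hp₀'⟩ := hh
    rw [hτ0 p₀ hp₀] at hp₀'
    have hP1 : ∀ y ∈ U, planeTension a₁ a₂ a₃ β f y ≠ 0 := fun y hy h => by
      have h1 := (hk y hy).trans (hk p₀ hp₀).symm
      simp only [h, mul_zero] at h1
      exact mul_ne_zero hp₀' hp₀' h1.symm
    have hβ1 : ∀ y ∈ U, deriv β (planeHeight a₁ a₂ a₃ y) ≠ 0 := fun y hy =>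
      (hP0 y hy).not.1 (hP1 y hy)
    refine ⟨fun y hy => (hPP hP1 (fun y hy i => (mul_eq_zero_iff_left (hβ1 y hy)).1 (hb' y hy i))
      -- The constant `c` is `f |H|` at `p₀`, where `H = β'/√s` is the mean curvature.
      y hy).1 (hb y hy), f p₀ * |deriv β (planeHeight a₁ a₂ a₃ p₀)| / √(1 + a₁ ^ 2 + a₂ ^ 2),
      div_pos (mul_pos (hfpos p₀ hp₀) (abs_pos.2 (hβ1 p₀ hp₀))) hr, fun y hy => ⟨hβ1 y hy, ?_⟩⟩
    have h1 := abs_eq_abs.2 (mul_self_eq_mul_self_iff.1 ((hk y hy).trans (hk p₀ hp₀).symm))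
    simp only [planeTension, abs_mul, abs_of_pos (hfpos y hy), abs_of_pos (hfpos p₀ hp₀),
      abs_of_pos (div_pos two_pos hs)] at h1
    rw [div_mul_cancel₀ _ hr.ne', eq_div_iff (abs_ne_zero.2 (hβ1 y hy))]
    exact mul_left_cancel₀ (div_pos two_pos hs).ne' h1
  · rintro ⟨hc, c, -, hcf⟩
    have hP1 : ∀ y ∈ U, planeTension a₁ a₂ a₃ β f y ≠ 0 := fun y hy =>
      (hP0 y hy).not.2 (hcf y hy).1
    -- The hypothesis controls only `f |β'|`; squaring removes the unknown sign of `β'`, and `2 P ∂P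
    -- = 0` with `P ≠ 0` then gives `∂P = 0`.
    have hsq : ∀ y ∈ U, planeTension a₁ a₂ a₃ β f y * planeTension a₁ a₂ a₃ β f y =
        (2 / (1 + a₁ ^ 2 + a₂ ^ 2) * (c * √(1 + a₁ ^ 2 + a₂ ^ 2))) ^ 2 := fun y hy => by
      have h1 : f y * |deriv β (planeHeight a₁ a₂ a₃ y)| = c * √(1 + a₁ ^ 2 + a₂ ^ 2) :=
        (eq_div_iff (abs_ne_zero.2 (hcf y hy).1)).1 (hcf y hy).2
      rw [← h1, ← mul_assoc, mul_pow, sq_abs, planeTension]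
      ring
    have hP2 : ∀ y ∈ U, ∀ i, pd i (planeTension a₁ a₂ a₃ β f) y = 0 := fun y hy i => by
      have h1 := (pd_mul (i := i) (hPd y hy) (hPd y hy)).symm.trans
        ((pd_congr (Filter.eventually_of_mem (hU.mem_nhds hy) hsq)).trans (pd_const _))
      rw [← two_mul] at h1
      simpa [hP1 y hy] using h1
    refine ⟨fun y hy => (hPP hP1 hP2 y hy).2 (hc y hy), fun hh => ?_⟩
    obtain ⟨y, hy⟩ := hUc.nonempty
    exact hP1 y hy ((hτ0 y hy).1 (hh y hy))

/-- This makes the nonconstancy clause of the theorem a consequence of the clause `β' ≠ 0`. -/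
lemma not_exists_eq_const_of_deriv_ne_zero {β : ℝ → ℝ} {J : Set ℝ} (hJ : IsOpen J) {z : ℝ}
    (hz : z ∈ J) (h : deriv β z ≠ 0) : ¬ ∃ b : ℝ, ∀ z ∈ J, β z = b := by
  rintro ⟨b, hb⟩
  have h1 : β =ᶠ[𝓝 z] fun _ => b := Filter.eventually_of_mem (hJ.mem_nhds hz) hb
  exact h (by rw [h1.deriv_eq, deriv_const])

end CoordGeom

end

theorem mainTheorem10 (a₁ a₂ a₃ : ℝ)
    (J : Set ℝ) (hJ : IsOpen J) (β : ℝ → ℝ) (hβ : ContDiffOn ℝ ∞ β J) (hβpos : ∀ z ∈ J, 0 < β z)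
    (U : Set (Fin 2 → ℝ)) (hU : IsOpen U) (hUc : IsConnected U)
    (hUJ : ∀ p ∈ U, CoordGeom.planeHeight a₁ a₂ a₃ p ∈ J)
    (f : (Fin 2 → ℝ) → ℝ) (hf : ContDiffOn ℝ ∞ f U) (hfpos : ∀ p ∈ U, 0 < f p) :
    (CoordGeom.IsProperBiharmonicOn (CoordGeom.planeMetric β a₁ a₂ a₃ f)
        (CoordGeom.confMetric β) (CoordGeom.planeMap a₁ a₂ a₃) U ↔
      (¬ ∃ b : ℝ, ∀ z ∈ J, β z = b) ∧
      (∀ p ∈ U, β (CoordGeom.planeHeight a₁ a₂ a₃ p)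
            * deriv (deriv β) (CoordGeom.planeHeight a₁ a₂ a₃ p)
          - 2 * deriv β (CoordGeom.planeHeight a₁ a₂ a₃ p) ^ 2 = 0) ∧
      ∃ c : ℝ, 0 < c ∧ ∀ p ∈ U, deriv β (CoordGeom.planeHeight a₁ a₂ a₃ p) ≠ 0 ∧
        f p = c * √(1 + a₁ ^ 2 + a₂ ^ 2) / |deriv β (CoordGeom.planeHeight a₁ a₂ a₃ p)|) ∧
    CoordGeom.HasConformalFactorOn (CoordGeom.planeMetric β a₁ a₂ a₃ f)
      (CoordGeom.confMetric β) (CoordGeom.planeMap a₁ a₂ a₃) (fun p => √(f p)) U ∧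
    CoordGeom.HasMeanCurvatureOn (CoordGeom.confMetric β) (CoordGeom.planeMap a₁ a₂ a₃)
      (CoordGeom.planeNormal β a₁ a₂ a₃)
      (fun p => deriv β (CoordGeom.planeHeight a₁ a₂ a₃ p) / √(1 + a₁ ^ 2 + a₂ ^ 2)) U := by
  have h0 : ∀ p ∈ U, β (CoordGeom.planeHeight a₁ a₂ a₃ p) ≠ 0 := fun p hp =>
    (hβpos _ (hUJ p hp)).ne'
  refine ⟨?_, CoordGeom.hasConformalFactorOn_planeMetric a₁ a₂ a₃ β hfpos,
    CoordGeom.hasMeanCurvatureOn_planeMap a₁ a₂ a₃ (fun p hp =>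
      (hβ.contDiffAt (hJ.mem_nhds (hUJ p hp))).differentiableAt (by simp)) h0⟩
  rw [CoordGeom.isProperBiharmonicOn_planeMap_iff hJ hβ hβpos hU hUc hUJ hf hfpos]
  refine ⟨fun h => ⟨?_, h⟩, And.right⟩
  obtain ⟨-, c, -, hc⟩ := h
  obtain ⟨p, hp⟩ := hUc.nonempty
  exact CoordGeom.not_exists_eq_const_of_deriv_ne_zero hJ (hUJ p hp) (hc p hp).1
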